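/- **Diagonal quotient identity.** Write $e(x)=e^{2\pi i x}$. For $\tau\in\mathbb{C}$ with $\operatorname{Im}\tau>0$ put $q=e(\tau)$ and $$\theta_\tau(\upsilon)=\frac1i\sum_{r\in\mathbb{Z}}(-1)^r\, e\!\left(\tfrac{(r+1/2)^2\tau}{2}\right) e\!\left(\tfrac{(2r+1)\upsilon}{2}\right),\qquad \Delta_\tau(a,b)=\frac{\theta_\tau'(0)\,\theta_\tau(a+b)}{\theta_\tau(a)\,\theta_\tau(b)},$$ and let $\delta=\delta_\tau$ be the meromorphic function on $\mathbb{C}^*\times\mathbb{C}^*$ determined by $\delta(e(a),e(b))=\frac1{2\pi i}\Delta_\tau(a,b)$; its poles are the points $(A,B)$ with $A\in q^{\mathbb{Z}}$ or $B\in q^{\mathbb{Z}}$. Let $n,m\ge 1$ be integers, and let $\mathbb{Z}_n$ act on $\mathbb{C}^m$ by scalar multiplication by $n$-th roots of unity. The equivariant elliptic class of $\mathbb{C}^m/\mathbb{Z}_n$ localized at the origin, computed from the fixed points of the blowup resolution (left-hand side), equals the localized orbifold elliptic class (right-hand side); that is, as meromorphic functions of $t_1,\dots,t_m\in\mathbb{C}^*$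 and of $h^{1/n}\in\mathbb{C}^*$, $$\sum_{i=1}^m\Big(\delta\big(t_i^n,h^{m/n}\big)\prod_{j\ne i}\delta\big(\tfrac{t_j}{t_i},h\big)\Big)=\frac1n\sum_{k,\ell=0}^{n-1}\Big(h^{-m\ell/n}\prod_{i=1}^m\delta\big(e\big(\tfrac kn-\tfrac \ell n\tau\big)t_i,h\big)\Big).$$ Explicitly: for every $h\in\mathbb{C}^*$ and every choice $\eta=h^{1/n}$ of an $n$-th root of $h$ (with $h^{m/n}:=\eta^m$ and $h^{-m\ell/n}:=\eta^{-m\ell}$), the equality holds at all points where no term has a pole, i.e. whenever $h,\ \eta^m,\ t_i^n$ (all $i$) and $t_j/t_i$ (all $i\ne j$) lie outside $q^{\mathbb{Z}}$. -/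

import Mathlib

noncomputable section

namespace EllipticDelta

/-- The normalised exponential `e(x) = exp (2 π i x)`. -/
def e (x : ℂ) : ℂ := Complex.exp (2 * Real.pi * Complex.I * x)

/-- The Jacobi theta function
`θ_τ(υ) = (1/i) ∑_{n ∈ ℤ} (-1)^n q₀^{(n+1/2)²} e((2n+1)υ/2)`, where `q₀ = e(τ/2)` and
`q₀^{(n+1/2)²}` means `e((n+1/2)² τ/2)`. -/
def theta (τ υ : ℂ) : ℂ :=
  1 / Complex.I *
    ∑' n : ℤ, (-1 : ℂ) ^ n * e (((n : ℂ) + 1 / 2) ^ 2 * τ / 2) * e ((2 * (n : ℂ) + 1) * υ / 2)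

/-- `Δ_τ(a, b) = θ_τ'(0) θ_τ(a + b) / (θ_τ(a) θ_τ(b))`, in additive variables. -/
def Del (τ a b : ℂ) : ℂ :=
  deriv (theta τ) 0 * theta τ (a + b) / (theta τ a * theta τ b)

/-- The function `δ_τ` on `ℂˣ × ℂˣ` determined by `δ_τ(e(a), e(b)) = Δ_τ(a, b) / (2 π i)`. It is
written with the principal logarithm; by `delta_e` the choice of logarithms does not matter. -/
def delta (τ A B : ℂ) : ℂ :=
  1 / (2 * Real.pi * Complex.I) *
    Del τ (Complex.log A / (2 * Real.pi * Complex.I)) (Complex.log B / (2 * Real.pi * Complex.I))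

/-- `θ_τ` in terms of Mathlib's two-variable theta function. -/
theorem theta_eq_jacobiTheta₂ (τ υ : ℂ) :
    theta τ υ = 1 / Complex.I * (e (τ / 8 + υ / 2) * jacobiTheta₂ (υ + 1 / 2 + τ / 2) τ) := by
  unfold theta jacobiTheta₂
  rw [← tsum_mul_left (a := e (τ / 8 + υ / 2))]
  congr 1
  refine tsum_congr fun n => ?_
  have h1 : ((-1 : ℂ) ^ n) = Complex.exp (Real.pi * Complex.I * n) := by
    rw [← Complex.exp_pi_mul_I, ← Complex.exp_int_mul]
    congr 1
    ring
  rw [h1, jacobiTheta₂_term, e, e, e, ← Complex.exp_add, ← Complex.exp_add, ← Complex.exp_add]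
  congr 1
  ring

/-- For `τ` in the upper half plane `θ_τ` is entire. -/
theorem differentiable_theta {τ : ℂ} (hτ : 0 < τ.im) : Differentiable ℂ (theta τ) := by
  have h : theta τ = fun υ => 1 / Complex.I *
      (Complex.exp (2 * Real.pi * Complex.I * (τ / 8 + υ / 2)) *
        jacobiTheta₂ (υ + 1 / 2 + τ / 2) τ) :=
    funext fun υ => theta_eq_jacobiTheta₂ τ υ
  intro υ
  rw [h]
  have h2 : DifferentiableAt ℂ (fun υ : ℂ => jacobiTheta₂ (υ + 1 / 2 + τ / 2) τ) υ :=
    (differentiableAt_jacobiTheta₂_fst (υ + 1 / 2 + τ / 2) hτ).comp υ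
      (f := fun υ : ℂ => υ + 1 / 2 + τ / 2) (by fun_prop)
  fun_prop

theorem theta_add_one (τ υ : ℂ) : theta τ (υ + 1) = -theta τ υ := by
  unfold theta
  rw [← mul_neg, ← tsum_neg]
  congr 1
  refine tsum_congr fun n => ?_
  have h : e ((2 * (n : ℂ) + 1) * (υ + 1) / 2) = -e ((2 * (n : ℂ) + 1) * υ / 2) := by
    unfold e
    rw [show 2 * Real.pi * Complex.I * ((2 * (n : ℂ) + 1) * (υ + 1) / 2)
      = 2 * Real.pi * Complex.I * ((2 * (n : ℂ) + 1) * υ / 2)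
        + (Real.pi * Complex.I + n * (2 * Real.pi * Complex.I)) by ring,
      Complex.exp_add, Complex.exp_add, Complex.exp_pi_mul_I, Complex.exp_int_mul_two_pi_mul_I]
    ring
  rw [h]
  ring

theorem Del_add_one (τ a b : ℂ) : Del τ (a + 1) b = Del τ a b := by
  unfold Del
  rw [show a + 1 + b = a + b + 1 by ring, theta_add_one, theta_add_one, mul_neg, neg_mul,
    neg_div_neg_eq]

theorem Del_comm (τ a b : ℂ) : Del τ a b = Del τ b a := by
  unfold Del
  rw [add_comm a b, mul_comm (theta τ a)]

theorem Del_add_int (τ a b : ℂ) (k : ℤ) : Del τ (a + k) b = Del τ a b := by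
  have h : Function.Periodic (fun a => Del τ a b) 1 := fun a => Del_add_one τ a b
  simpa using h.int_mul k a

/-- `δ_τ` is well defined: any logarithms may be used to compute it. -/
theorem delta_e (τ a b : ℂ) :
    delta τ (e a) (e b) = 1 / (2 * Real.pi * Complex.I) * Del τ a b := by
  have key : ∀ x : ℂ, ∃ k : ℤ, Complex.log (e x) / (2 * Real.pi * Complex.I) = x + k := by
    intro x
    obtain ⟨k, hk⟩ := Complex.exp_eq_exp_iff_exists_int.1
      (Complex.exp_log (Complex.exp_ne_zero (2 * Real.pi * Complex.I * x)))
    refine ⟨k, ?_⟩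
    rw [e, hk, div_eq_iff Complex.two_pi_I_ne_zero]
    ring
  obtain ⟨k, hk⟩ := key a
  obtain ⟨l, hl⟩ := key b
  rw [delta, hk, hl, Del_add_int, Del_comm, Del_add_int, Del_comm]

end EllipticDelta

end

noncomputable section

namespace EllipticDelta

open Filter Topology

/-! The identity is a residue theorem on `ℂ / (ℤ + ℤτ)`. Write `t i = e (x i)`, `η = e w`, `h = e (n
w)`, and consider `f u = Δ(n u, m w) ∏ i, Δ(x i - u, n w)`. The multipliers of its factors under `u
↦ u + τ` cancel, so `f` is elliptic. Its poles are simple: at the `x i`, where the residues are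
minus the terms of the blowup sum, and at the `n`-torsion points, where the residues are the terms
of the orbifold sum (`sum_Del_mul_prod_Del`).

No contour is used for the vanishing of the sum of residues (`sum_residues_eq_zero`). Subtracting `∑
r i * (θ'/θ)(u - p i)` from `f` removes all poles and leaves a function with additive increment `2πi
∑ r i` under `τ`; Liouville's theorem forces that increment to vanish.

This requires the zeros of `θ` to be exactly the lattice points, and simple. They are read off from
the triple product `θ = C * thetaProd`, again by Liouville. The constant `C` is never computed: if
`C = 0`, every `delta` is `0` and both sides vanish. -/

/-! ### The exponential `e` and the lattice `ℤ + ℤτ`. -/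

lemma e_add (x y : ℂ) : e (x + y) = e x * e y := by
  simp only [e, mul_add, Complex.exp_add]

lemma e_zero : e 0 = 1 := by simp [e]

lemma e_ne_zero (x : ℂ) : e x ≠ 0 := Complex.exp_ne_zero _

lemma e_neg (x : ℂ) : e (-x) = (e x)⁻¹ := by simp [e, Complex.exp_neg]

lemma e_int_mul (r : ℤ) (x : ℂ) : e (r * x) = e x ^ r := by
  rw [e, e, ← Complex.exp_int_mul]
  congr 1
  ring

lemma e_nat_mul (r : ℕ) (x : ℂ) : e (r * x) = e x ^ r := by
  simpa using e_int_mul r x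

lemma exists_e_eq {z : ℂ} (hz : z ≠ 0) : ∃ x, e x = z := by
  refine ⟨Complex.log z / (2 * Real.pi * Complex.I), ?_⟩
  rw [e, mul_div_cancel₀ _ Complex.two_pi_I_ne_zero, Complex.exp_log hz]

lemma e_eq_one_iff {x : ℂ} : e x = 1 ↔ ∃ s : ℤ, x = s := by
  rw [e, Complex.exp_eq_one_iff]
  refine exists_congr fun s => ?_
  rw [mul_comm, mul_left_inj' Complex.two_pi_I_ne_zero]

lemma e_eq_zpow_iff {τ v : ℂ} {r : ℤ} : e v = e τ ^ r ↔ ∃ s : ℤ, v = r * τ + s := by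
  rw [← e_int_mul, ← div_eq_one_iff_eq (e_ne_zero _), div_eq_mul_inv, ← e_neg, ← e_add,
    e_eq_one_iff]
  refine exists_congr fun s => ?_
  constructor <;> intro h <;> linear_combination h

@[fun_prop]
lemma differentiable_e : Differentiable ℂ e := by
  unfold e
  fun_prop

lemma hasDerivAt_e (x : ℂ) : HasDerivAt e (2 * Real.pi * Complex.I * e x) x := by
  unfold e
  simpa [mul_comm] using ((hasDerivAt_id x).const_mul (2 * Real.pi * Complex.I)).cexp

lemma norm_e_lt_one {τ : ℂ} (hτ : 0 < τ.im) : ‖e τ‖ < 1 := by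
  have := Real.pi_pos
  rw [e, Complex.norm_exp, Real.exp_lt_one_iff]
  simp
  positivity

/-- `1` and `τ` are linearly independent over `ℝ`. -/
lemma eq_zero_of_real_mul_add_real_eq_zero {τ : ℂ} (hτ : 0 < τ.im) {a b : ℝ}
    (h : (a : ℂ) * τ + b = 0) : a = 0 ∧ b = 0 := by
  have h1 := congrArg Complex.im h
  have ha : a = 0 := by simpa [hτ.ne'] using h1
  refine ⟨ha, ?_⟩
  simpa [ha] using h

/-! ### Liouville's theorem for quasi-periodic functions. -/

/-- A continuous function with periods `1` and `τ` is bounded. -/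
lemma isBounded_range_of_periodic {τ : ℂ} (hτ : 0 < τ.im) {g : ℂ → ℂ} (hg : Continuous g)
    (h1 : Function.Periodic g 1) (h2 : Function.Periodic g τ) :
    Bornology.IsBounded (Set.range g) := by
  have hc : IsCompact ((fun p : ℝ × ℝ => g (p.1 * τ + p.2)) ''
      (Set.Icc 0 1 ×ˢ Set.Icc 0 1)) :=
    (isCompact_Icc.prod isCompact_Icc).image (by fun_prop)
  refine hc.isBounded.subset ?_
  rintro _ ⟨z, rfl⟩
  set a : ℝ := z.im / τ.im with ha
  set b : ℝ := z.re - a * τ.re with hb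
  have hz : z = a * τ + b := by
    apply Complex.ext
    · simp [hb]
    · simp [ha, hτ.ne']
  refine ⟨(Int.fract a, Int.fract b), ⟨⟨Int.fract_nonneg _, (Int.fract_lt_one _).le⟩,
    ⟨Int.fract_nonneg _, (Int.fract_lt_one _).le⟩⟩, ?_⟩
  have e1 := (h2.int_mul ⌊a⌋) (Int.fract a * τ + Int.fract b)
  have e2 := (h1.int_mul ⌊b⌋) (Int.fract a * τ + Int.fract b + ⌊a⌋ * τ)
  simp only
  rw [← e1, ← e2]
  congr 1
  rw [hz, Int.fract, Int.fract]
  push_cast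
  ring

/-- An entire function which is periodic under `1` and additively quasi-periodic under `τ` is
constant. -/
lemma entire_eq_const_of_quasiperiodic {τ : ℂ} (hτ : 0 < τ.im) {g : ℂ → ℂ} {c : ℂ}
    (hg : Differentiable ℂ g) (h1 : ∀ u, g (u + 1) = g u) (h2 : ∀ u, g (u + τ) = g u + c) :
    c = 0 ∧ ∀ u, g u = g 0 := by
  -- Differentiating kills `c`, so `deriv g` is doubly periodic, hence constant; `g` is then affine,
  -- and period `1` makes its slope zero.
  have hd : Differentiable ℂ (deriv g) := fun x =>
    (hg.analyticAt x).deriv.differentiableAt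
  have p1 : Function.Periodic (deriv g) 1 := fun u => by
    rw [← deriv_comp_add_const, funext h1]
  have p2 : Function.Periodic (deriv g) τ := fun u => by
    rw [← deriv_comp_add_const, funext h2, deriv_add_const]
  have hconst := fun u => hd.apply_eq_apply_of_bounded
    (isBounded_range_of_periodic hτ hd.continuous p1 p2) u 0
  have hlin : ∀ u, g u - deriv g 0 * u = g 0 := by
    intro u
    have := is_const_of_deriv_eq_zero (f := fun u => g u - deriv g 0 * u) (by fun_prop)
      (fun x => by
        rw [deriv_fun_sub (hg x) (by fun_prop), deriv_const_mul_id, hconst x, sub_self]) u 0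
    simpa using this
  have h0 : deriv g 0 = 0 := by
    have := hlin 1
    have h := h1 0
    rw [zero_add] at h
    rw [h] at this
    simpa using this
  have hc : ∀ u, g u = g 0 := fun u => by simpa [h0] using hlin u
  refine ⟨?_, hc⟩
  have := h2 0
  rw [hc] at this
  simpa using this

lemma tendsto_add_const_nhdsNE (a x : ℂ) : Tendsto (fun u => u + a) (𝓝[≠] x) (𝓝[≠] (x + a)) :=
  ((continuous_add_const a).tendsto' x (x + a) rfl).inf (by simp)

/-- Liouville's theorem for meromorphic functions without poles that are periodic under `1` and
additively quasi-periodic under `τ`. -/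
lemma meromorphic_eventuallyEq_const_of_quasiperiodic {τ : ℂ} (hτ : 0 < τ.im) {g : ℂ → ℂ} {c : ℂ}
    (hg : ∀ x, MeromorphicAt g x) (hlim : ∀ x, ∃ a, Tendsto g (𝓝[≠] x) (𝓝 a))
    (h1 : ∀ x, ∀ᶠ u in 𝓝[≠] x, g (u + 1) = g u)
    (h2 : ∀ x, ∀ᶠ u in 𝓝[≠] x, g (u + τ) = g u + c) :
    c = 0 ∧ ∃ C, ∀ x, ∀ᶠ u in 𝓝[≠] x, g u = C := by
  have hgU : MeromorphicOn g Set.univ := fun x _ => hg x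
  -- The normal form fills in the removable singularities, so `G` is entire.
  set G := toMeromorphicNFOn g Set.univ with hG
  have hEq : ∀ x, g =ᶠ[𝓝[≠] x] G := fun x =>
    (hgU.toMeromorphicNFOn_eq_self_on_nhdsNE (Set.mem_univ x)).symm
  have hGa : ∀ x, AnalyticAt ℂ G x := fun x => by
    rw [← (meromorphicNFOn_toMeromorphicNFOn g Set.univ
      (Set.mem_univ x)).meromorphicOrderAt_nonneg_iff_analyticAt,
      meromorphicOrderAt_toMeromorphicNFOn hgU (Set.mem_univ x)]
    exact (tendsto_nhds_iff_meromorphicOrderAt_nonneg (hg x)).1 (hlim x)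
  have hGd : Differentiable ℂ G := fun x => (hGa x).differentiableAt
  have hGc := hGd.continuous
  have key : ∀ F : ℂ → ℂ, Continuous F → ∀ H : ℂ → ℂ, Continuous H →
      ∀ x, F =ᶠ[𝓝[≠] x] H → F x = H x := fun F hF H hH x h =>
    tendsto_nhds_unique (hF.continuousAt.tendsto.mono_left nhdsWithin_le_nhds)
      ((hH.continuousAt.tendsto.mono_left nhdsWithin_le_nhds).congr' h.symm)
  have H1 : ∀ u, G (u + 1) = G u := fun x => by
    refine key (fun u => G (u + 1)) (by fun_prop) G hGc x ?_
    filter_upwards [h1 x, hEq x, (tendsto_add_const_nhdsNE 1 x).eventually (hEq (x + 1))] with u a b d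
    rw [← d, a, b]
  have H2 : ∀ u, G (u + τ) = G u + c := fun x => by
    refine key (fun u => G (u + τ)) (by fun_prop) (fun u => G u + c) (by fun_prop) x ?_
    filter_upwards [h2 x, hEq x, (tendsto_add_const_nhdsNE τ x).eventually (hEq (x + τ))] with u a b d
    rw [← d, a, b]
  obtain ⟨hc, hconst⟩ := entire_eq_const_of_quasiperiodic hτ hGd H1 H2
  exact ⟨hc, G 0, fun x => (hEq x).mono fun u hu => by rw [hu, hconst]⟩

/-- The limit of a meromorphic function at a point exists if its singularity there is weaker than
a simple pole. -/
lemma exists_tendsto_of_tendsto_sub_mul {g : ℂ → ℂ} {x : ℂ} (hg : MeromorphicAt g x)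
    (h : Tendsto (fun u => (u - x) * g u) (𝓝[≠] x) (𝓝 0)) :
    ∃ a, Tendsto g (𝓝[≠] x) (𝓝 a) := by
  rw [tendsto_nhds_iff_meromorphicOrderAt_nonneg hg]
  have hid : MeromorphicAt (fun u : ℂ => u - x) x := by fun_prop
  have h1 : meromorphicOrderAt (fun u : ℂ => u - x) x = (1 : ℤ) := by
    rw [meromorphicOrderAt_eq_int_iff hid]
    exact ⟨fun _ => 1, analyticAt_const, one_ne_zero, by simp⟩
  have h2 := (tendsto_zero_iff_meromorphicOrderAt_pos (hid.fun_mul hg)).1 h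
  change 0 < meromorphicOrderAt ((fun u : ℂ => u - x) * g) x at h2
  rw [meromorphicOrderAt_mul hid hg, h1] at h2
  cases ho : meromorphicOrderAt g x with
  | top => simp
  | coe n =>
    rw [ho] at h2
    norm_cast at h2 ⊢
    omega

/-! ### The triple product and its zeros. -/

/-- The infinite product `∏_{k ≥ 0} (1 - q ^ k X)`. -/
def qProd (q X : ℂ) : ℂ := ∏' k : ℕ, (1 + -(q ^ k * X))

lemma summable_norm_qProd_term {q : ℂ} (hq : ‖q‖ < 1) (X : ℂ) :
    Summable fun k : ℕ => ‖-(q ^ k * X)‖ := by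
  simpa using (summable_geometric_of_lt_one (norm_nonneg q) hq).mul_right ‖X‖

lemma qProd_eq_mul {q : ℂ} (hq : ‖q‖ < 1) (X : ℂ) :
    qProd q X = (1 - X) * qProd q (q * X) := by
  have hs : Multipliable fun k : ℕ => 1 + -(q ^ (k + 1) * X) := by
    refine multipliable_one_add_of_summable ?_
    simpa [pow_succ, mul_assoc] using summable_norm_qProd_term hq (q * X)
  have h := tprod_eq_zero_mul' (f := fun k : ℕ => 1 + -(q ^ k * X)) hs
  simp only [pow_zero, one_mul, pow_succ, mul_assoc, ← sub_eq_add_neg] at h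
  simp only [qProd, ← sub_eq_add_neg, h]

lemma qProd_ne_zero {q : ℂ} (hq : ‖q‖ < 1) {X : ℂ} (hX : ∀ k : ℕ, q ^ k * X ≠ 1) :
    qProd q X ≠ 0 := by
  refine tprod_one_add_ne_zero_of_summable (fun k h => hX k ?_) (summable_norm_qProd_term hq X)
  linear_combination -h

lemma differentiable_qProd {q : ℂ} (hq : ‖q‖ < 1) : Differentiable ℂ (qProd q) := by
  intro X
  have hb : DifferentiableOn ℂ (qProd q) (Metric.ball 0 (‖X‖ + 1)) := by
    refine (Summable.hasProdLocallyUniformlyOn_nat_one_add Metric.isOpen_ball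
      ((summable_geometric_of_lt_one (norm_nonneg q) hq).mul_right (‖X‖ + 1))
      (f := fun k Y => -(q ^ k * Y)) (Eventually.of_forall fun k Y hY => ?_)
      (fun k => by fun_prop)).differentiableOn (Eventually.of_forall fun s => ?_)
      Metric.isOpen_ball
    · rw [norm_neg, norm_mul, norm_pow]
      gcongr
      exact (mem_ball_zero_iff.1 hY).le
    · exact DifferentiableOn.fun_finsetProd fun _ _ => by fun_prop
  exact hb.differentiableAt (Metric.isOpen_ball.mem_nhds (by simp))

/-- The product side of the Jacobi triple product, up to a constant factor. -/
def thetaProd (τ v : ℂ) : ℂ := e (-v / 2) * (qProd (e τ) (e v) * qProd (e τ) (e τ * e (-v)))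

lemma differentiable_thetaProd {τ : ℂ} (hτ : 0 < τ.im) : Differentiable ℂ (thetaProd τ) := by
  have h := differentiable_qProd (norm_e_lt_one hτ)
  unfold thetaProd
  fun_prop

lemma thetaProd_add_one (τ v : ℂ) : thetaProd τ (v + 1) = -thetaProd τ v := by
  have h1 : e (v + 1) = e v := by simpa using e_add v 1 |>.trans (by simp [e])
  have h2 : e (-(v + 1)) = e (-v) := by rw [e_neg, h1, e_neg]
  have h3 : e (-(v + 1) / 2) = -e (-v / 2) := by
    rw [show -(v + 1) / 2 = -v / 2 + -(1 / 2) by ring, e_add, e_neg]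
    have : e (1 / 2) = -1 := by
      rw [e, show 2 * Real.pi * Complex.I * (1 / 2) = Real.pi * Complex.I by ring,
        Complex.exp_pi_mul_I]
    rw [this]
    norm_num
  rw [thetaProd, h1, h2, h3, thetaProd]
  ring

/-- The shift removes the factor `1 - e v` from the first product and adds `1 - e (-v) = -e (-v) *
(1 - e v)` to the second. -/
lemma thetaProd_add_tau {τ : ℂ} (hτ : 0 < τ.im) (v : ℂ) :
    thetaProd τ (v + τ) = -e (-τ / 2 - v) * thetaProd τ v := by
  have hq := norm_e_lt_one hτ
  have h1 : e τ * e (-(v + τ)) = e (-v) := by rw [← e_add]; congr 1; ring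
  have h2 : e (-(v + τ) / 2) = e (-τ / 2) * e (-v / 2) := by rw [← e_add]; congr 1; ring
  have h3 : e (-τ / 2 - v) = e (-τ / 2) * e (-v) := by rw [← e_add, sub_eq_add_neg]
  have h4 : e v * e (-v) = 1 := by rw [← e_add, add_neg_cancel, e_zero]
  rw [thetaProd, h1, h2, h3, thetaProd, qProd_eq_mul hq (e v), qProd_eq_mul hq (e (-v)),
    e_add, mul_comm (e v) (e τ)]
  linear_combination -(e (-τ / 2) * e (-v / 2) * qProd (e τ) (e τ * e v) *
    qProd (e τ) (e τ * e (-v))) * h4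

/-- A convergent product vanishes only if a factor does; the first product yields the exponents `r ≤
0`, the second `r ≥ 1`. -/
lemma exists_zpow_of_thetaProd_eq_zero {τ : ℂ} (hτ : 0 < τ.im) {v : ℂ} (hv : thetaProd τ v = 0) :
    ∃ r : ℤ, e v = e τ ^ r := by
  have hq := norm_e_lt_one hτ
  by_contra! hne
  refine (mul_ne_zero (e_ne_zero _) (mul_ne_zero (qProd_ne_zero hq fun k hk => ?_)
    (qProd_ne_zero hq fun k hk => ?_))) hv
  · refine hne (-k) ?_
    rw [zpow_neg, zpow_natCast]
    exact eq_inv_of_mul_eq_one_right hk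
  · refine hne (k + 1 : ℕ) ?_
    rw [zpow_natCast, pow_succ]
    rw [e_neg, ← mul_assoc] at hk
    exact ((mul_inv_eq_one₀ (e_ne_zero v)).1 hk).symm

/-- The zero at `0` comes from the single factor `1 - e v`; the cofactor `S` does not vanish there.
-/
lemma hasDerivAt_thetaProd_zero {τ : ℂ} (hτ : 0 < τ.im) :
    ∃ d ≠ 0, HasDerivAt (thetaProd τ) d 0 := by
  have hq := norm_e_lt_one hτ
  have hqp := differentiable_qProd hq
  set S : ℂ → ℂ := fun v => e (-v / 2) * (qProd (e τ) (e τ * e v) * qProd (e τ) (e τ * e (-v)))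
    with hS
  have hSd : Differentiable ℂ S := by fun_prop
  have hS0 : S 0 ≠ 0 := by
    have : qProd (e τ) (e τ) ≠ 0 := qProd_ne_zero hq fun k hk => by
      rw [← pow_succ] at hk
      have := congrArg norm hk
      rw [norm_pow, norm_one] at this
      exact (pow_lt_one₀ (norm_nonneg _) hq k.succ_ne_zero).ne this
    simp [hS, e_zero, this]
  have heq : thetaProd τ = fun v => (1 - e v) * S v := by
    funext v
    rw [thetaProd, qProd_eq_mul hq (e v)]
    simp only [hS]
    ring
  rw [heq]
  refine ⟨_, ?_, ((hasDerivAt_e 0).const_sub 1).mul (hSd 0).hasDerivAt⟩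
  simp [e_zero, hS0, Complex.I_ne_zero, Real.pi_ne_zero]

/-! ### Zeros of `θ`. -/

/-- At `z = 1/2 + τ/2` the points `z` and `-z` differ by the period `1 + τ`; evenness of
`jacobiTheta₂` and the multiplier `exp (πi) = -1` give `jacobiTheta₂ z τ = -jacobiTheta₂ z τ`. -/
lemma theta_zero (τ : ℂ) : theta τ 0 = 0 := by
  have h1 := jacobiTheta₂_add_left' (-(1 / 2) - τ / 2) τ
  have h2 := jacobiTheta₂_add_left (-(1 / 2) - τ / 2 + τ) τ
  have h3 := jacobiTheta₂_neg_left (1 / 2 + τ / 2) τ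
  rw [show -(1 / 2 + τ / 2) = -(1 / 2) - τ / 2 by ring] at h3
  rw [show -(1 / 2) - τ / 2 + τ + 1 = 1 / 2 + τ / 2 by ring, h1, h3,
    show -Real.pi * Complex.I * (τ + 2 * (-(1 / 2) - τ / 2)) = Real.pi * Complex.I by ring,
    Complex.exp_pi_mul_I] at h2
  have h4 : jacobiTheta₂ (0 + 1 / 2 + τ / 2) τ = 0 := by
    rw [zero_add]
    linear_combination (1 / 2) * h2
  rw [theta_eq_jacobiTheta₂, h4, mul_zero, mul_zero]

lemma theta_add_tau (τ v : ℂ) : theta τ (v + τ) = -e (-τ / 2 - v) * theta τ v := by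
  rw [theta_eq_jacobiTheta₂, theta_eq_jacobiTheta₂,
    show v + τ + 1 / 2 + τ / 2 = v + 1 / 2 + τ / 2 + τ by ring, jacobiTheta₂_add_left',
    show Complex.exp (-Real.pi * Complex.I * (τ + 2 * (v + 1 / 2 + τ / 2)))
      = e (-τ - v) * e (-1 / 2) by rw [← e_add, e]; congr 1; ring]
  have h : e (τ / 8 + (v + τ) / 2) = e (τ / 8 + v / 2) * e (τ / 2) := by
    rw [← e_add]; congr 1; ring
  have h' : e (-τ / 2 - v) = e (τ / 2) * e (-τ - v) := by rw [← e_add]; congr 1; ring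
  have h'' : e (-1 / 2) = -1 := by
    rw [e, show 2 * Real.pi * Complex.I * (-1 / 2) = -(Real.pi * Complex.I) by ring,
      Complex.exp_neg, Complex.exp_pi_mul_I]
    norm_num
  rw [h, h', h'']
  ring

lemma eventually_ne_zero_nhdsNE {f : ℂ → ℂ} (hf : Differentiable ℂ f) (h : ∃ z, f z ≠ 0) (x : ℂ) :
    ∀ᶠ u in 𝓝[≠] x, f u ≠ 0 := by
  refine (hf.analyticAt x).eventually_eq_zero_or_eventually_ne_zero.resolve_left fun h0 => ?_
  obtain ⟨z, hz⟩ := h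
  have hfa : AnalyticOnNhd ℂ f Set.univ := fun y _ => hf.analyticAt y
  exact hz (hfa.eqOn_zero_of_preconnected_of_eventuallyEq_zero isPreconnected_univ
    (Set.mem_univ x) h0 (Set.mem_univ z))

lemma thetaProd_exists_ne_zero {τ : ℂ} (hτ : 0 < τ.im) : ∃ z, thetaProd τ z ≠ 0 := by
  by_contra! h
  obtain ⟨d, hd, hd'⟩ := hasDerivAt_thetaProd_zero hτ
  rw [funext h] at hd'
  exact hd (hd'.unique (hasDerivAt_const 0 0))

/-- The Jacobi triple product, with an unspecified constant. -/
lemma exists_theta_eq_mul_thetaProd {τ : ℂ} (hτ : 0 < τ.im) :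
    ∃ C, ∀ v, theta τ v = C * thetaProd τ v := by
  have hP := differentiable_thetaProd hτ
  have hT := differentiable_theta hτ
  set g : ℂ → ℂ := fun v => theta τ v / thetaProd τ v with hg
  have p1 : Function.Periodic g 1 := fun u => by
    simp only [hg, theta_add_one, thetaProd_add_one, neg_div_neg_eq]
  have p2 : Function.Periodic g τ := fun u => by
    simp only [hg, theta_add_tau, thetaProd_add_tau hτ]
    rw [mul_div_mul_left _ _ (neg_ne_zero.2 (e_ne_zero _))]
  -- Both functions vanish at `0`, the denominator simply, so the quotient of slopes converges.
  have hlim0 : ∃ a, Tendsto g (𝓝[≠] 0) (𝓝 a) := by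
    obtain ⟨d, hd, hd'⟩ := hasDerivAt_thetaProd_zero hτ
    have hP0 : thetaProd τ 0 = 0 := by
      rw [thetaProd, neg_zero, e_zero, qProd_eq_mul (norm_e_lt_one hτ) 1]
      simp
    have s1 := (hT 0).hasDerivAt.tendsto_slope
    have s2 := hd'.tendsto_slope
    refine ⟨_, (s1.div s2 hd).congr' ?_⟩
    filter_upwards [self_mem_nhdsWithin] with u hu
    have hu' : u ≠ 0 := hu
    simp only [Pi.div_apply, slope_def_field, theta_zero, hP0, sub_zero, hg]
    rw [div_div_div_cancel_right₀ hu']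
  have hlim : ∀ x, ∃ a, Tendsto g (𝓝[≠] x) (𝓝 a) := by
    intro x
    by_cases hx : thetaProd τ x = 0
    · obtain ⟨r, hr⟩ := exists_zpow_of_thetaProd_eq_zero hτ hx
      obtain ⟨s, rfl⟩ := e_eq_zpow_iff.1 hr
      obtain ⟨a, ha⟩ := hlim0
      refine ⟨a, ?_⟩
      have hs : Tendsto (fun u => u - (r * τ + s)) (𝓝[≠] (r * τ + s)) (𝓝[≠] 0) :=
        ((by fun_prop : Continuous fun u : ℂ => u - (r * τ + s)).tendsto' _ _ (sub_self _)).inf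
          (by simp [sub_eq_zero])
      refine (ha.comp hs).congr fun u => ?_
      have h1 := p1.int_mul s (u - (r * τ + s))
      have h2 := p2.int_mul r (u - (r * τ + s) + s * 1)
      rw [Function.comp_apply, ← h1, ← h2]
      congr 1
      ring
    · exact ⟨_, ((hT.continuous.continuousAt.div hP.continuous.continuousAt hx).tendsto).mono_left
        nhdsWithin_le_nhds⟩
  obtain ⟨-, C, hC⟩ := meromorphic_eventuallyEq_const_of_quasiperiodic (c := 0) hτ (g := g)
    (fun x => (hT.analyticAt x).meromorphicAt.div (hP.analyticAt x).meromorphicAt) hlim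
    (fun x => Eventually.of_forall p1) (fun x => Eventually.of_forall fun u => by rw [p2, add_zero])
  refine ⟨C, fun v => ?_⟩
  have h : theta τ =ᶠ[𝓝[≠] v] fun u => C * thetaProd τ u := by
    filter_upwards [hC v, eventually_ne_zero_nhdsNE hP (thetaProd_exists_ne_zero hτ) v]
      with u hu hu'
    rw [← hu, hg, div_mul_cancel₀ _ hu']
  exact tendsto_nhds_unique (hT.continuous.continuousAt.tendsto.mono_left nhdsWithin_le_nhds)
    (((hP.continuous.const_mul C).continuousAt.tendsto.mono_left nhdsWithin_le_nhds).congr'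
      h.symm)

/-- The zeros of `θ_τ` (if it is not identically zero) are the lattice points, and they are
simple. -/
lemma theta_zeros {τ : ℂ} (hτ : 0 < τ.im) :
    (∀ v, theta τ v = 0) ∨
      deriv (theta τ) 0 ≠ 0 ∧ ∀ v, theta τ v = 0 ↔ ∃ r s : ℤ, v = r * τ + s := by
  obtain ⟨C, hC⟩ := exists_theta_eq_mul_thetaProd hτ
  rcases eq_or_ne C 0 with rfl | hC0
  · exact Or.inl fun v => by rw [hC, zero_mul]
  refine Or.inr ⟨?_, fun v => ⟨fun h => ?_, ?_⟩⟩
  · obtain ⟨d, hd, hd'⟩ := hasDerivAt_thetaProd_zero hτ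
    rw [funext hC, (hd'.const_mul C).deriv]
    exact mul_ne_zero hC0 hd
  · rw [hC, mul_eq_zero, or_iff_right hC0] at h
    obtain ⟨r, hr⟩ := exists_zpow_of_thetaProd_eq_zero hτ h
    exact ⟨r, e_eq_zpow_iff.1 hr⟩
  · rintro ⟨r, s, rfl⟩
    have h1 : Function.Periodic (fun v => theta τ v = 0) 1 := fun v => by
      simp [theta_add_one]
    have h2 : Function.Periodic (fun v => theta τ v = 0) τ := fun v => by
      simp [theta_add_tau, e_ne_zero]
    have h := (h1.int_mul s (r * τ)).trans (by simpa using h2.int_mul r 0)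
    rw [mul_one] at h
    exact h.mpr (theta_zero τ)

/-- Stated as periodicity of a predicate so that `Function.Periodic.int_mul` carries a limit at one
point to all its lattice translates. -/
lemma periodic_exists_tendsto {g : ℂ → ℂ} {a c : ℂ}
    (h : ∀ x, ∀ᶠ u in 𝓝[≠] x, g (u + a) = g u + c) :
    Function.Periodic (fun x => ∃ b, Tendsto g (𝓝[≠] x) (𝓝 b)) a := by
  intro x
  refine propext ⟨fun ⟨b, hb⟩ => ⟨b - c, ?_⟩, fun ⟨b, hb⟩ => ⟨b + c, ?_⟩⟩
  · refine ((hb.comp (tendsto_add_const_nhdsNE a x)).sub_const c).congr' ?_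
    filter_upwards [h x] with u hu
    rw [Function.comp_apply, hu, add_sub_cancel_right]
  · have hs := tendsto_add_const_nhdsNE (-a) (x + a)
    rw [add_neg_cancel_right] at hs
    refine ((hb.comp hs).add_const c).congr' ?_
    filter_upwards [hs.eventually (h x)] with u hu
    rw [Function.comp_apply, ← hu, neg_add_cancel_right]

/-! ### The residue theorem. -/

section Residues

variable {τ : ℂ}

lemma tendsto_div_theta (hτ : 0 < τ.im) (hd : deriv (theta τ) 0 ≠ 0) :
    Tendsto (fun u => u / theta τ u) (𝓝[≠] 0) (𝓝 (deriv (theta τ) 0)⁻¹) := by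
  refine (((differentiable_theta hτ 0).hasDerivAt.tendsto_slope).inv₀ hd).congr fun u => ?_
  rw [slope_def_field, theta_zero, sub_zero, sub_zero, inv_div]

lemma theta_exists_ne_zero (hd : deriv (theta τ) 0 ≠ 0) : ∃ z, theta τ z ≠ 0 := by
  by_contra! h
  rw [funext h] at hd
  simp at hd

lemma logDeriv_theta_add_one (u : ℂ) :
    logDeriv (theta τ) (u + 1) = logDeriv (theta τ) u := by
  rw [logDeriv_apply, logDeriv_apply, ← deriv_comp_add_const, funext (theta_add_one τ),
    theta_add_one, deriv.fun_neg, neg_div_neg_eq]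

/-- The increment is the logarithmic derivative of the multiplier `-e (-τ / 2 - v)`. -/
lemma logDeriv_theta_add_tau (hτ : 0 < τ.im) {u : ℂ} (hu : theta τ u ≠ 0) :
    logDeriv (theta τ) (u + τ) = logDeriv (theta τ) u + -(2 * Real.pi * Complex.I) := by
  have h1 : HasDerivAt (fun v => -e (-τ / 2 - v))
      (2 * Real.pi * Complex.I * e (-τ / 2 - u)) u := by
    refine ((hasDerivAt_e (-τ / 2 - u)).comp u
      ((hasDerivAt_id u).const_sub (-τ / 2))).neg.congr_deriv ?_
    ring
  have h2 := (h1.mul (differentiable_theta hτ u).hasDerivAt).deriv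
  have h3 := e_ne_zero (-τ / 2 - u)
  rw [logDeriv_apply, logDeriv_apply, ← deriv_comp_add_const, funext (theta_add_tau τ),
    theta_add_tau]
  change deriv ((fun v => -e (-τ / 2 - v)) * theta τ) u / _ = _
  rw [h2]
  generalize e (-τ / 2 - u) = c at h3
  field_simp
  ring

/-- The sum of the residues of an elliptic function with simple poles vanishes. -/
lemma sum_residues_eq_zero (hτ : 0 < τ.im) (hd : deriv (theta τ) 0 ≠ 0)
    (hz : ∀ v, theta τ v = 0 → ∃ r s : ℤ, v = r * τ + s) {ι : Type*} [Fintype ι]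
    (p r : ι → ℂ) {f : ℂ → ℂ} (hf : ∀ x, MeromorphicAt f x) (h1 : ∀ u, f (u + 1) = f u)
    (h2 : ∀ u, f (u + τ) = f u) (hp : ∀ i j, i ≠ j → theta τ (p i - p j) ≠ 0)
    (hreg : ∀ x, (∀ i, theta τ (x - p i) ≠ 0) → ContinuousAt f x)
    (hres : ∀ i, Tendsto (fun u => (u - p i) * f u) (𝓝[≠] (p i)) (𝓝 (r i))) :
    ∑ i, r i = 0 := by
  classical
  have hT := differentiable_theta hτ
  have hT' : Differentiable ℂ (deriv (theta τ)) := fun x =>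
    (hT.analyticAt x).deriv.differentiableAt
  have hsub : ∀ a x : ℂ, Tendsto (fun u => u - a) (𝓝[≠] x) (𝓝[≠] (x - a)) := fun a x => by
    simpa only [sub_eq_add_neg] using tendsto_add_const_nhdsNE (-a) x
  set Z := logDeriv (theta τ) with hZ
  have hZc : ∀ {v}, theta τ v ≠ 0 → ContinuousAt Z v := fun {v} hv =>
    (hT' v).continuousAt.div (hT v).continuousAt hv
  have hZ0 : Tendsto (fun u => u * Z u) (𝓝[≠] 0) (𝓝 1) := by
    have := ((hT' 0).continuousAt.tendsto.mono_left nhdsWithin_le_nhds).mul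
      (tendsto_div_theta hτ hd)
    rw [mul_inv_cancel₀ hd] at this
    refine this.congr fun u => ?_
    rw [hZ, logDeriv_apply]
    ring
  have hZm : ∀ a x, MeromorphicAt (fun u => Z (u - a)) x := fun a x =>
    MeromorphicAt.fun_div
      ((hT'.comp (differentiable_id.sub_const a)).analyticAt x).meromorphicAt
      ((hT.comp (differentiable_id.sub_const a)).analyticAt x).meromorphicAt
  set g : ℂ → ℂ := fun u => f u - ∑ i, r i * Z (u - p i) with hg
  have hgm : ∀ x, MeromorphicAt g x := fun x =>
    (hf x).fun_sub (MeromorphicAt.fun_sum fun i _ =>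
      (MeromorphicAt.const (r i) x).fun_mul (hZm (p i) x))
  have hg1 : ∀ u, g (u + 1) = g u := fun u => by
    simp only [hg, h1, add_sub_right_comm, hZ, logDeriv_theta_add_one]
  have hg2 : ∀ x, ∀ᶠ u in 𝓝[≠] x, g (u + τ) = g u + 2 * Real.pi * Complex.I * ∑ i, r i := by
    intro x
    have hev : ∀ᶠ u in 𝓝[≠] x, ∀ i, theta τ (u - p i) ≠ 0 :=
      eventually_all.2 fun i => (hsub (p i) x).eventually
        (eventually_ne_zero_nhdsNE hT (theta_exists_ne_zero hd) _)
    filter_upwards [hev] with u hu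
    have : ∀ i, Z (u + τ - p i) = Z (u - p i) + -(2 * Real.pi * Complex.I) := fun i => by
      rw [add_sub_right_comm, hZ, logDeriv_theta_add_tau hτ (hu i)]
    simp only [hg, h2, this, mul_add, Finset.sum_add_distrib, ← Finset.sum_mul]
    ring
  have hlimp : ∀ i, ∃ a, Tendsto g (𝓝[≠] (p i)) (𝓝 a) := by
    intro i
    -- The residue `r i` of `f` cancels that of `r i * Z (u - p i)`; the other summands are
    -- continuous at `p i` by `hp`.
    refine exists_tendsto_of_tendsto_sub_mul (hgm _) ?_
    have t1 : Tendsto (fun u => r i * ((u - p i) * Z (u - p i))) (𝓝[≠] (p i)) (𝓝 (r i * 1)) := by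
      refine (hZ0.comp ?_).const_mul (r i)
      simpa using hsub (p i) (p i)
    have t2 : Tendsto (fun u => (u - p i) * ∑ j ∈ Finset.univ.erase i, r j * Z (u - p j))
        (𝓝[≠] (p i)) (𝓝 0) := by
      have hc : ContinuousAt (fun u => (u - p i) * ∑ j ∈ Finset.univ.erase i, r j * Z (u - p j))
          (p i) := by
        refine ContinuousAt.mul (by fun_prop) (tendsto_finsetSum _ fun j hj => ?_)
        refine ContinuousAt.mul continuousAt_const ?_
        exact ContinuousAt.comp (f := fun u => u - p j) (g := Z)
          (hZc (hp i j (Finset.ne_of_mem_erase hj).symm)) (by fun_prop)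
      simpa using hc.tendsto.mono_left (nhdsWithin_le_nhds (s := {p i}ᶜ))
    have t3 := ((hres i).sub t1).sub t2
    rw [mul_one, sub_self, sub_zero] at t3
    refine t3.congr fun u => ?_
    simp only [hg]
    rw [← Finset.add_sum_erase _ _ (Finset.mem_univ i)]
    ring
  have hlim : ∀ x, ∃ a, Tendsto g (𝓝[≠] x) (𝓝 a) := by
    intro x
    by_cases hx : ∀ i, theta τ (x - p i) ≠ 0
    · have hc : ContinuousAt g x := by
        refine (hreg x hx).sub (tendsto_finsetSum _ fun j _ => ?_)
        refine ContinuousAt.mul continuousAt_const ?_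
        exact ContinuousAt.comp (f := fun u => u - p j) (g := Z) (hZc (hx j)) (by fun_prop)
      exact ⟨_, hc.tendsto.mono_left nhdsWithin_le_nhds⟩
    · push Not at hx
      obtain ⟨i, hi⟩ := hx
      obtain ⟨a, b, hab⟩ := hz _ hi
      have q1 := (periodic_exists_tendsto (c := 0) (fun x => Eventually.of_forall fun u => by
        rw [hg1, add_zero] : ∀ x, ∀ᶠ u in 𝓝[≠] x, g (u + 1) = g u + 0)).int_mul b
          (p i + a * τ)
      have q2 := (periodic_exists_tendsto hg2).int_mul a (p i)
      rw [show x = p i + a * τ + b * 1 by linear_combination hab]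
      exact (q1.trans q2).mpr (hlimp i)
  obtain ⟨h0, -⟩ := meromorphic_eventuallyEq_const_of_quasiperiodic hτ hgm hlim
    (fun x => Eventually.of_forall hg1) hg2
  exact (mul_eq_zero.1 h0).resolve_left Complex.two_pi_I_ne_zero

/-! ### Quasi-periodicity and poles of `Δ`. -/

lemma Del_add_int_mul_tau (hτ : 0 < τ.im) (a b : ℂ) (r : ℤ) :
    Del τ (a + r * τ) b = e (-(r * b)) * Del τ a b := by
  have hτ0 : τ ≠ 0 := by rintro rfl; simp at hτ
  have h1 : ∀ a, Del τ (a + τ) b = e (-b) * Del τ a b := fun a => by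
    have : e (-τ / 2 - (a + b)) = e (-τ / 2 - a) * e (-b) := by rw [← e_add]; congr 1; ring
    rw [Del, add_right_comm, theta_add_tau, theta_add_tau, this, Del]
    have hc := e_ne_zero (-τ / 2 - a)
    generalize e (-τ / 2 - a) = c at hc
    rcases eq_or_ne (theta τ a) 0 with h | h
    · simp [h]
    rcases eq_or_ne (theta τ b) 0 with h' | h'
    · simp [h']
    field_simp
  -- The factor `e (a * b / τ)` absorbs the multiplier `e (-b)`, so that negative `r` is covered by
  -- periodicity too.
  have hper : Function.Periodic (fun a => Del τ a b * e (a * b / τ)) τ := fun a => by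
    have : e (-b) * e ((a + τ) * b / τ) = e (a * b / τ) := by
      rw [← e_add]
      congr 1
      field_simp
      ring
    simp only [h1]
    rw [← this]
    ring
  have h2 : Del τ (a + r * τ) b * e ((a + r * τ) * b / τ) = Del τ a b * e (a * b / τ) :=
    hper.int_mul r a
  have h3 : e (a * b / τ) = e (-(r * b)) * e ((a + r * τ) * b / τ) := by
    rw [← e_add]
    congr 1
    field_simp
    ring
  refine mul_right_cancel₀ (e_ne_zero ((a + r * τ) * b / τ)) ?_
  rw [h2, h3]
  ring

lemma meromorphicAt_Del (hτ : 0 < τ.im) {φ : ℂ → ℂ} (hφ : Differentiable ℂ φ) (b x : ℂ) :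
    MeromorphicAt (fun u => Del τ (φ u) b) x := by
  have hT := differentiable_theta hτ
  have h1 : Differentiable ℂ fun u => deriv (theta τ) 0 * theta τ (φ u + b) := by fun_prop
  have h2 : Differentiable ℂ fun u => theta τ (φ u) * theta τ b := by fun_prop
  exact (h1.analyticAt x).meromorphicAt.fun_div (h2.analyticAt x).meromorphicAt

lemma continuousAt_Del (hτ : 0 < τ.im) {φ : ℂ → ℂ} {b x : ℂ} (hφ : ContinuousAt φ x)
    (hx : theta τ (φ x) ≠ 0) (hb : theta τ b ≠ 0) :
    ContinuousAt (fun u => Del τ (φ u) b) x := by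
  have hT := (differentiable_theta hτ).continuous
  exact ContinuousAt.div (by fun_prop) (by fun_prop) (mul_ne_zero hx hb)

lemma tendsto_mul_Del (hτ : 0 < τ.im) (hd : deriv (theta τ) 0 ≠ 0) {b : ℂ} (hb : theta τ b ≠ 0) :
    Tendsto (fun a => a * Del τ a b) (𝓝[≠] 0) (𝓝 1) := by
  have hT := (differentiable_theta hτ).continuous
  have h1 : Tendsto (fun a => deriv (theta τ) 0 * theta τ (a + b) / theta τ b) (𝓝[≠] 0)
      (𝓝 (deriv (theta τ) 0)) := by
    refine ((by fun_prop : Continuous fun a => deriv (theta τ) 0 * theta τ (a + b) / theta τ b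
      ).tendsto' 0 _ ?_).mono_left nhdsWithin_le_nhds
    rw [zero_add, mul_div_cancel_right₀ _ hb]
  have h2 := h1.mul (tendsto_div_theta hτ hd)
  rw [mul_inv_cancel₀ hd] at h2
  refine h2.congr fun a => ?_
  rw [Del]
  ring

/-- `Δ_τ(c(u - p), b)` has a simple pole at `u = p` with residue `1 / c`. -/
lemma tendsto_sub_mul_Del (hτ : 0 < τ.im) (hd : deriv (theta τ) 0 ≠ 0) {b c : ℂ}
    (hb : theta τ b ≠ 0) (hc : c ≠ 0) (p : ℂ) :
    Tendsto (fun u => (u - p) * Del τ (c * (u - p)) b) (𝓝[≠] p) (𝓝 (1 / c)) := by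
  have hs : Tendsto (fun u => c * (u - p)) (𝓝[≠] p) (𝓝[≠] 0) :=
    ((by fun_prop : Continuous fun u => c * (u - p)).tendsto' p 0 (by simp)).inf
      (by simp [hc, sub_eq_zero])
  refine (((tendsto_mul_Del hτ hd hb).comp hs).div_const c).congr fun u => ?_
  rw [Function.comp_apply]
  field_simp

end Residues

/-! ### The elliptic function `f` and its residues. -/

/-- The diagonal quotient identity in additive variables. -/
lemma sum_Del_mul_prod_Del {τ : ℂ} (hτ : 0 < τ.im) (hd : deriv (theta τ) 0 ≠ 0)
    (hz : ∀ v, theta τ v = 0 ↔ ∃ r s : ℤ, v = r * τ + s) {n m : ℕ} (hn : n ≠ 0)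
    (x : Fin m → ℂ) (w : ℂ)
    (hx : ∀ i, theta τ (n * x i) ≠ 0) (hxx : ∀ i j, i ≠ j → theta τ (x j - x i) ≠ 0)
    (hnw : theta τ (n * w) ≠ 0) (hmw : theta τ (m * w) ≠ 0) :
    ∑ i, Del τ (n * x i) (m * w) * ∏ j ∈ Finset.univ.erase i, Del τ (x j - x i) (n * w) =
      ∑ kl : Fin n × Fin n, 1 / (n : ℂ) * (e (-(m * (kl.2 : ℕ) * w)) *
        ∏ i, Del τ ((kl.1 : ℕ) / n - (kl.2 : ℕ) / n * τ + x i) (n * w)) := by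
  have hnC : (n : ℂ) ≠ 0 := Nat.cast_ne_zero.2 hn
  have hnZ : (0 : ℤ) < n := by omega
  have hneg : ∀ v, theta τ (-v) = 0 ↔ theta τ v = 0 := fun v => by
    rw [hz, hz]
    constructor <;> rintro ⟨r, s, h⟩ <;> refine ⟨-r, -s, ?_⟩ <;> push_cast <;>
      linear_combination -h
  have hmul : ∀ v, theta τ v = 0 → theta τ (n * v) = 0 := fun v => by
    rw [hz, hz]
    rintro ⟨r, s, rfl⟩
    exact ⟨n * r, n * s, by push_cast; ring⟩
  -- The points `-y kl` represent the zeros of `θ (n u)` modulo the lattice.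
  set y : Fin n × Fin n → ℂ := fun kl => (kl.1 : ℕ) / n - (kl.2 : ℕ) / n * τ with hy
  have hny : ∀ kl, n * y kl = (kl.1 : ℕ) - (kl.2 : ℕ) * τ := fun kl => by
    simp only [hy]
    field_simp
  have hxy : ∀ i kl, theta τ (x i + y kl) ≠ 0 := fun i kl h => by
    refine hx i ((hz _).2 ?_)
    obtain ⟨r, s, h⟩ := (hz _).1 (hmul _ h)
    rw [mul_add, hny] at h
    exact ⟨r + (kl.2 : ℕ), s - (kl.1 : ℕ), by push_cast; linear_combination h⟩
  have hyy : ∀ kl kl', kl ≠ kl' → theta τ (y kl' - y kl) ≠ 0 := fun kl kl' hne h => by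
    refine hne ?_
    obtain ⟨r, s, h⟩ := (hz _).1 h
    have h' : (n : ℂ) * (y kl' - y kl) = n * (r * τ + s) := by rw [h]
    rw [mul_sub, hny, hny] at h'
    obtain ⟨ha, hb⟩ := eq_zero_of_real_mul_add_real_eq_zero hτ
      (a := (((kl.2 : ℕ) - (kl'.2 : ℕ) - n * r : ℤ) : ℝ))
      (b := (((kl'.1 : ℕ) - (kl.1 : ℕ) - n * s : ℤ) : ℝ))
      (by push_cast; linear_combination h')
    have ha' : ((kl.2 : ℕ) : ℤ) - (kl'.2 : ℕ) = n * r := by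
      have := Int.cast_eq_zero.1 ha
      omega
    have hb' : ((kl'.1 : ℕ) : ℤ) - (kl.1 : ℕ) = n * s := by
      have := Int.cast_eq_zero.1 hb
      omega
    have key : ∀ (a b : Fin n) (t : ℤ), ((a : ℕ) : ℤ) - (b : ℕ) = n * t → a = b := by
      intro a b t hab
      have h0 := Int.eq_zero_of_abs_lt_dvd (Dvd.intro t hab.symm)
        (abs_sub_lt_of_nonneg_of_lt (by positivity) (by exact_mod_cast a.2) (by positivity)
          (by exact_mod_cast b.2))
      apply Fin.ext
      omega
    exact Prod.ext (key _ _ _ hb').symm (key _ _ _ ha')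
  set f : ℂ → ℂ := fun u => Del τ (n * u) (m * w) * ∏ i, Del τ (x i - u) (n * w) with hf
  set p : Fin m ⊕ Fin n × Fin n → ℂ := Sum.elim x (fun kl => -y kl) with hp
  set res : Fin m ⊕ Fin n × Fin n → ℂ := Sum.elim
    (fun i => -(Del τ (n * x i) (m * w) *
      ∏ j ∈ Finset.univ.erase i, Del τ (x j - x i) (n * w)))
    (fun kl => 1 / (n : ℂ) * (e (-(m * (kl.2 : ℕ) * w)) * ∏ i, Del τ (y kl + x i) (n * w)))
    with hres
  have hfm : ∀ z, MeromorphicAt f z := fun z =>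
    (meromorphicAt_Del hτ (by fun_prop) _ _).fun_mul
      (MeromorphicAt.fun_prod fun i _ => meromorphicAt_Del hτ (by fun_prop) _ _)
  have hf1 : ∀ u, f (u + 1) = f u := fun u => by
    have h1 : Del τ (n * (u + 1)) (m * w) = Del τ (n * u) (m * w) := by
      simpa [mul_add] using Del_add_int τ (n * u) (m * w) n
    have h2 : ∀ i, Del τ (x i - (u + 1)) (n * w) = Del τ (x i - u) (n * w) := fun i => by
      rw [← Del_add_one, sub_add_eq_sub_sub, sub_add_cancel]
    simp only [hf, h1, h2]
  have hf2 : ∀ u, f (u + τ) = f u := fun u => by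
    have h1 : Del τ (n * (u + τ)) (m * w) = e (-(n * (m * w))) * Del τ (n * u) (m * w) := by
      simpa [mul_add] using Del_add_int_mul_tau hτ (n * u) (m * w) n
    have h2 : ∀ i, Del τ (x i - (u + τ)) (n * w) = e (n * w) * Del τ (x i - u) (n * w) :=
      fun i => by
        have := Del_add_int_mul_tau hτ (x i - u) (n * w) (-1)
        push_cast at this
        rw [neg_one_mul, neg_one_mul, neg_neg, ← sub_eq_add_neg, ← sub_add_eq_sub_sub] at this
        exact this
    -- Here the second argument `m w` is forced: the `m` factors `e (n w)` must cancel `e (-(n m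
    -- w))`.
    have h3 : e (-(n * (m * w))) * e (n * w) ^ m = 1 := by
      rw [← e_nat_mul, ← e_add, ← e_zero]
      congr 1
      ring
    simp only [hf, h1, h2, Finset.prod_mul_distrib, Finset.prod_const, Finset.card_univ,
      Fintype.card_fin]
    linear_combination (Del τ (n * u) (m * w) * ∏ i, Del τ (x i - u) (n * w)) * h3
  have hpp : ∀ i j, i ≠ j → theta τ (p i - p j) ≠ 0 := by
    rintro (i | kl) (j | kl') hij
    · exact hxx j i fun h => hij (by rw [h])
    · simpa [hp] using hxy i kl'
    · have := (hneg _).not.2 (hxy j kl)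
      simpa [hp, neg_add, add_comm, sub_eq_add_neg] using this
    · have := hyy kl kl' fun h => hij (by rw [h])
      simpa [hp, sub_eq_add_neg, add_comm] using this
  have hreg : ∀ z, (∀ i, theta τ (z - p i) ≠ 0) → ContinuousAt f z := by
    intro z hzp
    refine ContinuousAt.mul (continuousAt_Del hτ (by fun_prop) (fun h => ?_) hmw)
      (tendsto_finsetProd _ fun i _ => continuousAt_Del hτ (by fun_prop) (fun h => ?_) hnw)
    · obtain ⟨r, s, h⟩ := (hz _).1 h
      -- From `n z = r τ + s` and `-y kl = (l τ - k) / n`, the indices are `l ≡ r` and `k ≡ -s`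
      -- modulo `n`.
      have hl : (r % n).toNat < n := by have := Int.emod_lt_of_pos r hnZ; omega
      have hk : ((-s) % n).toNat < n := by have := Int.emod_lt_of_pos (-s) hnZ; omega
      refine hzp (Sum.inr (⟨_, hk⟩, ⟨_, hl⟩)) ((hz _).2 ⟨r / n, -(-s / n), ?_⟩)
      have cast_toNat : ∀ a : ℤ, (((a % n).toNat : ℕ) : ℂ) = a - n * (a / n : ℤ) := fun a => by
        have h0 := Int.emod_nonneg a hnZ.ne'
        have h1 := Int.toNat_of_nonneg h0
        have h2 := Int.emod_add_mul_ediv a n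
        have h3 : (((a % n).toNat : ℕ) : ℤ) = a - n * (a / n) := by omega
        exact_mod_cast congrArg (Int.cast : ℤ → ℂ) h3
      have hy' := hny (⟨_, hk⟩, ⟨_, hl⟩)
      simp only [cast_toNat] at hy'
      refine mul_left_cancel₀ hnC ?_
      simp only [hp, Sum.elim_inr]
      push_cast at hy' ⊢
      linear_combination h + hy'
    · refine hzp (Sum.inl i) ?_
      rw [← hneg] at h
      simpa [hp] using h
  have hlim : ∀ i, Tendsto (fun u => (u - p i) * f u) (𝓝[≠] (p i)) (𝓝 (res i)) := by
    rintro (i | kl)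
    · have t1 := tendsto_sub_mul_Del hτ hd hnw (c := -1) (by norm_num) (x i)
      have t2 : ContinuousAt (fun u => Del τ (n * u) (m * w) *
          ∏ j ∈ Finset.univ.erase i, Del τ (x j - u) (n * w)) (x i) :=
        ContinuousAt.mul (continuousAt_Del hτ (by fun_prop) (hx i) hmw)
          (tendsto_finsetProd _ fun j hj => continuousAt_Del hτ (by fun_prop)
            (hxx i j (Finset.ne_of_mem_erase hj).symm) hnw)
      have t3 := t1.mul (t2.tendsto.mono_left (nhdsWithin_le_nhds (s := {x i}ᶜ)))
      simp only [hp, hres, Sum.elim_inl]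
      convert t3 using 2 with u
      · simp only [hf]
        rw [← Finset.mul_prod_erase _ _ (Finset.mem_univ i),
          show -1 * (u - x i) = x i - u by ring]
        ring
      · ring
    · have t1 := tendsto_sub_mul_Del hτ hd hmw hnC (-y kl)
      have t2 : ContinuousAt (fun u => e (-(m * (kl.2 : ℕ) * w)) *
          ∏ i, Del τ (x i - u) (n * w)) (-y kl) :=
        ContinuousAt.mul continuousAt_const (tendsto_finsetProd _ fun j hj =>
          continuousAt_Del hτ (by fun_prop) (by simpa using hxy j kl) hnw)
      have t3 := t1.mul (t2.tendsto.mono_left (nhdsWithin_le_nhds (s := {-y kl}ᶜ)))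
      simp only [hp, hres, Sum.elim_inr]
      convert t3 using 2 with u
      -- Since `n u = n (u + y kl) + l τ - k`, recentring at the pole costs `e (-(l m w)) = η ^ (-m
      -- l)`, the orbifold weight; the factor `1 / n` is the residue of `Δ(n (u + y kl), m w)`.
      · have h1 := Del_add_int τ (n * (u - -y kl) + ((kl.2 : ℕ) : ℤ) * τ) (m * w)
          (-((kl.1 : ℕ) : ℤ))
        rw [Del_add_int_mul_tau hτ] at h1
        have h2 : n * (u - -y kl) + ((kl.2 : ℕ) : ℤ) * τ + ((-((kl.1 : ℕ) : ℤ) : ℤ) : ℂ)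
            = n * u := by
          push_cast
          linear_combination hny kl
        rw [h2] at h1
        have h3 : -(((kl.2 : ℕ) : ℤ) * (m * w)) = -(m * (kl.2 : ℕ) * w) := by
          push_cast
          ring
        rw [h3] at h1
        simp only [hf, h1]
        ring
      · simp only [sub_neg_eq_add, add_comm]
  have hsum := sum_residues_eq_zero hτ hd (fun v => (hz v).1) p res hfm hf1 hf2 hpp hreg hlim
  rw [Fintype.sum_sum_type] at hsum
  simp only [hres, Sum.elim_inl, Sum.elim_inr, Finset.sum_neg_distrib] at hsum
  linear_combination -hsum

end EllipticDelta

end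

/-! ### Return to multiplicative variables. -/

open EllipticDelta in
theorem mainTheorem6 (n m : ℕ) (hn : 1 ≤ n) (hm : 1 ≤ m) (τ : ℂ) (hτ : 0 < τ.im)
    (t : Fin m → ℂ) (h η : ℂ) (ht : ∀ i, t i ≠ 0) (hh : h ≠ 0) (hη : η ^ n = h)
    (ht_pole : ∀ i, ∀ r : ℤ, t i ^ n ≠ EllipticDelta.e τ ^ r)
    (htt_pole : ∀ i j, i ≠ j → ∀ r : ℤ, t j / t i ≠ EllipticDelta.e τ ^ r)
    (hh_pole : ∀ r : ℤ, h ≠ EllipticDelta.e τ ^ r)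
    (hη_pole : ∀ r : ℤ, η ^ m ≠ EllipticDelta.e τ ^ r) :
    ∑ i : Fin m, EllipticDelta.delta τ (t i ^ n) (η ^ m) *
        ∏ j ∈ Finset.univ.erase i, EllipticDelta.delta τ (t j / t i) h =
      1 / (n : ℂ) * ∑ k ∈ Finset.range n, ∑ l ∈ Finset.range n,
        (η ^ (m * l))⁻¹ *
          ∏ i : Fin m, EllipticDelta.delta τ
            (EllipticDelta.e ((k : ℂ) / (n : ℂ) - (l : ℂ) / (n : ℂ) * τ) * t i) h := by
  rcases theta_zeros hτ with h0 | ⟨hd, hz⟩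
  -- The case `C = 0`. The products on the right vanish because `m ≥ 1` makes them nonempty.
  · have hdelta : ∀ A B, delta τ A B = 0 := fun A B => by simp [delta, Del, h0]
    have hm0 : m ≠ 0 := by omega
    simp [hdelta, hm0]
  have hn0 : n ≠ 0 := by omega
  have hη0 : η ≠ 0 := by
    rintro rfl
    exact hh (by rw [← hη, zero_pow hn0])
  obtain ⟨w, rfl⟩ := exists_e_eq hη0
  choose x hx using fun i => exists_e_eq (ht i)
  obtain rfl : t = fun i => e (x i) := funext fun i => (hx i).symm
  have hthe : ∀ v, (∀ r : ℤ, e v ≠ e τ ^ r) → theta τ v ≠ 0 := fun v hv h => by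
    obtain ⟨r, hr⟩ := (hz v).1 h
    exact hv r (e_eq_zpow_iff.2 hr)
  have hdiv : ∀ i j, e (x j) / e (x i) = e (x j - x i) := fun i j => by
    rw [sub_eq_add_neg, e_add, e_neg, div_eq_mul_inv]
  subst hη
  simp only [← e_nat_mul, hdiv, ← e_add, ← e_neg, delta_e] at *
  have key := sum_Del_mul_prod_Del hτ hd hz hn0 x w (fun i => hthe _ (ht_pole i))
    (fun i j hij => hthe _ (htt_pole i j hij)) (hthe _ hh_pole) (hthe _ hη_pole)
  set c := 1 / (2 * (Real.pi : ℂ) * Complex.I) with hc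
  -- Every term on either side has `m` factors `delta`, hence the same power of `1 / (2πi)`.
  have hcard : ∀ i : Fin m, c * c ^ (Finset.univ.erase i).card = c ^ m := fun i => by
    rw [Finset.card_erase_of_mem (Finset.mem_univ i), Finset.card_univ, Fintype.card_fin,
      ← pow_succ', Nat.sub_add_cancel hm]
  have hL : ∀ i, c * Del τ (n * x i) (m * w) *
      ∏ j ∈ Finset.univ.erase i, c * Del τ (x j - x i) (n * w) =
      c ^ m * (Del τ (n * x i) (m * w) *
        ∏ j ∈ Finset.univ.erase i, Del τ (x j - x i) (n * w)) := fun i => by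
    rw [Finset.prod_mul_distrib, Finset.prod_const, ← hcard i]
    ring
  simp only [hL, ← Finset.mul_sum, key]
  rw [Fintype.sum_prod_type, ← Fin.sum_univ_eq_sum_range (fun k => ∑ l ∈ Finset.range n, _)]
  simp only [← Fin.sum_univ_eq_sum_range, Finset.prod_mul_distrib, Finset.prod_const,
    Finset.card_univ, Fintype.card_fin, Finset.mul_sum]
  refine Finset.sum_congr rfl fun k _ => Finset.sum_congr rfl fun l _ => ?_
  push_cast
  ring
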